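/- **Model.** A randomized streaming algorithm $\mathcal A$ with token universe $\mathcal U$ and answer set $\mathcal Z$, using $s$ bits of space and $r$ random bits, consists of three functions $\mathrm{init}\colon\{0,1\}^r\to\{0,1\}^s$, $\mathrm{process}\colon\{0,1\}^s\times\mathcal U\times\{0,1\}^r\to\{0,1\}^s$ and $\mathrm{query}\colon\{0,1\}^s\times\{0,1\}^r\to\mathcal Z$ (the random string can be read at any time and does not count towards the space). An adaptive adversary is an arbitrary function $\mathrm{next}\colon\mathcal Z^*\to\mathcal U$. For a random string $R$ the game produces $w_0=\mathrm{init}(R)$, $z_0=\mathrm{query}(w_0,R)$ and, for $i\ge 1$, $x_i=\mathrm{next}(z_0,\dots,z_{i-1})$, $w_i=\mathrm{process}(w_{i-1},x_i,R)$, $z_i=\mathrm{query}(w_i,R)$. **Theorem (Main lower bound).** Let $L,n,K$ be nonnegative integers with $2K\le n$, $L+1\le K$ and $L\ge 12\ln(4n)$. Consider insert-only streams of edges on the vertex set $[n]$ (tokens are unordered pairs of distinct vertices), and let $\mathcal A$ be a streaming algorithm with answers in $[K]^n$ that uses $s$ bits of space and any number $r$ of random bits. Let $m\ge\lfloor nL/2\rfloor$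 (so that $m$ is at least the number of edges of any $n$-vertex graph of maximum degree at most $L$). Suppose that for every adaptive adversary, with probability at least $1/4$ over a uniformly random $R\in\{0,1\}^r$, the following holds for all $1\le i\le m$: if the edges $x_1,\dots,x_i$ are distinct and form a graph of maximum degree at most $L$, then $z_i$ is a proper coloring of that graph. Then $$ s\;\ge\;\frac{1}{40\ln 2}\cdot\frac{nL^2}{K}-3 . $$ -/

import Mathlib

/-- A randomized one-pass streaming algorithm over the token universe `U` with answers in `Z`,
running in `s` bits of space and using `r` random bits. The random string may be read at any time
and is not charged to the space. -/
structure StreamAlg (U Z : Type) (s r : ℕ) where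
  /-- initial memory state -/
  init : (Fin r → Bool) → (Fin s → Bool)
  /-- update of the memory state when a token arrives -/
  process : (Fin s → Bool) → U → (Fin r → Bool) → (Fin s → Bool)
  /-- answer computed from the current memory state -/
  query : (Fin s → Bool) → (Fin r → Bool) → Z

namespace StreamAlg

variable {U Z : Type} {s r : ℕ}

/-- The memory state after the stream `σ` has been processed with random string `R`. -/
def state (A : StreamAlg U Z s r) (R : Fin r → Bool) (σ : List U) : Fin s → Bool :=
  σ.foldl (fun w x => A.process w x R) (A.init R)

/-- The answer to a query made after the stream `σ`, with random string `R`. -/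
def output (A : StreamAlg U Z s r) (R : Fin r → Bool) (σ : List U) : Z :=
  A.query (A.state R σ) R

/-- The stream `(x₁, …, xᵢ)` that the adaptive adversary with next-token function `next` generates
against `A` run with random string `R`: `x_{i+1} = next (z₀, …, zᵢ)`, where `z_j` is the answer of
`A` after `(x₁, …, x_j)` (`List.inits` lists the prefixes by increasing length, from the empty one
to the whole list). -/
def advStream (A : StreamAlg U Z s r) (next : List Z → U) (R : Fin r → Bool) : ℕ → List U
  | 0 => []
  | i + 1 =>
    A.advStream next R i ++ [next ((A.advStream next R i).inits.map (A.output R))]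

end StreamAlg

/-- The probability of an event over a uniformly random string of `r` bits. -/
noncomputable def coinProb {r : ℕ} (E : Set (Fin r → Bool)) : ℝ :=
  (E.ncard : ℝ) / 2 ^ r

/-- `A` is a `δ`-error adversarially robust algorithm, for streams of length up to `m`, for the
streaming problem given by the relation `f`: against every adaptive adversary, with probability at
least `1 - δ`, all the answers `z₁, …, z_m` are correct for the respective prefixes. -/
def StreamAlg.IsRobust {U Z : Type} {s r : ℕ} (A : StreamAlg U Z s r)
    (f : List U → Z → Prop) (δ : ℝ) (m : ℕ) : Prop :=
  ∀ next : List Z → U,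
    1 - δ ≤ coinProb {R | ∀ i : ℕ, 1 ≤ i → i ≤ m →
      f (A.advStream next R i) (A.output R (A.advStream next R i))}

/-- Tokens of an insert-only graph stream on the vertex set `Fin n`: unordered pairs of distinct
vertices. -/
abbrev EdgeToken (n : ℕ) : Type := {e : Sym2 (Fin n) // ¬ e.IsDiag}

/-- The graph whose edges are listed by the stream `σ`. -/
def streamGraph {n : ℕ} (σ : List (EdgeToken n)) : SimpleGraph (Fin n) :=
  SimpleGraph.fromEdgeSet {e | e ∈ σ.map Subtype.val}

/-- The streams an algorithm with degree limit `L` has to handle: every edge is listed once, and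
the graph has maximum degree at most `L`. -/
def IsDegreeBoundedStream {n : ℕ} (L : ℕ) (σ : List (EdgeToken n)) : Prop :=
  σ.Nodup ∧ ∀ v : Fin n, ((streamGraph σ).neighborSet v).ncard ≤ L

/-- The `K`-coloring problem for insert-only streams of `n`-vertex graphs of maximum degree at most
`L`. A valid answer is a vector in `[K]ⁿ` giving adjacent vertices different colors; on streams
outside of the promise nothing is required. -/
def ColoringProblem (n L K : ℕ) (σ : List (EdgeToken n)) (z : Fin n → Fin K) : Prop :=
  IsDegreeBoundedStream L σ → ∀ u v : Fin n, (streamGraph σ).Adj u v → z u ≠ z v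

/-!
The memory of the algorithm is forced to encode a random graph, by an adversary that extracts many
non-edges of this graph from the memory alone.

Split `Fin n` into `q ≈ n / (2 K)` blocks of nearly equal size. Let `ω` be a family of `l ≈ L / 4`
independent uniform permutations that preserve the blocks, and let `S(ω)` be the graph of the pairs
`{v, ω h v}`; its degrees are at most `2 l`. The adversary inserts `S(ω)` and then, one at a time,
probing edges inside blocks which are monochromatic under the current answer and whose ends have
probing degree less than `d = L - 2 l`, until there are none. The degree limit `L` is respected, so
as long as the answers are correct the probing edges are not in `S(ω)` (`probes_spec`). When probing
stops, the vertices of a block with probing degree less than `d` have different colors, so there are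
at most `K` of them (`card_unsaturated_le`). The probing graph `B` is determined by the random
string and the memory state after `S(ω)`.

The `l` permutations of `ω` therefore avoid the graph `B`, which has degree `d` at all but at most
`K` vertices of each block. Bregman's theorem (`card_perm_le_exp`, with Schrijver's proof) bounds
the number of permutations avoiding `B`: a vertex of degree `d` in a block of size `N` costs a
factor of about `exp (-d / N)`, and `exp (-19 d / (20 N))` is enough here
(`card_avoidingPerms_le`). Hence each pair of a random string and a memory state is compatible with
at most a fraction `exp (-l E)` of the families `ω`, where
`E = 19/20 * d * q * (1 - K / ⌊n / q⌋)`. As at least a quarter of all pairs of a random string and a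
family are correct, `1/4 ≤ 2 ^ s * exp (-l E)` (`quarter_le_of_isRobust`).

Permutations are used in place of independent random edges because they make the degrees of `S(ω)`
bounded without any loss. This leaves room for the rounding of `n / (2 K)` in the final estimate
(`exponent_ge`).
-/

namespace RobustColoring

/-! ### Bregman's bound on permutations with restricted positions -/

/-- The logarithm of the geometric-mean factor `(r!)^(1/r)` of Bregman's bound. -/
noncomputable def logFactRoot (r : ℕ) : ℝ := Real.log (r.factorial : ℝ) / r

lemma mul_logFactRoot (r : ℕ) : (r : ℝ) * logFactRoot r = Real.log (r.factorial : ℝ) := by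
  rcases Nat.eq_zero_or_pos r with rfl | hr
  · simp [logFactRoot]
  · have : (r : ℝ) ≠ 0 := by positivity
    unfold logFactRoot
    field_simp

lemma log_add_pred_mul_logFactRoot {r : ℕ} (hr : 1 ≤ r) :
    Real.log r + ((r : ℝ) - 1) * logFactRoot (r - 1) = (r : ℝ) * logFactRoot r := by
  obtain ⟨k, rfl⟩ := Nat.exists_eq_add_of_le' hr
  have h := mul_logFactRoot k
  rw [mul_logFactRoot, Nat.factorial_succ]
  push_cast
  rw [Real.log_mul (by positivity) (by positivity), ← h]
  simp

/-- Averaging over the image of one point: this is the convexity step in Schrijver's proof of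
Bregman's theorem, in the form it takes when `log x ≤ x - 1` is used. -/
lemma card_mul_log_card_le {β : Type*} [DecidableEq β] {γ : Type*} (P : Finset γ) (f : γ → β)
    (R : Finset β) (hf : ∀ σ ∈ P, f σ ∈ R) :
    (P.card : ℝ) * Real.log P.card ≤ P.card * Real.log R.card +
      ∑ σ ∈ P, Real.log ((P.filter fun ρ => f ρ = f σ).card : ℝ) := by
  classical
  rcases P.eq_empty_or_nonempty with rfl | hP
  · simp
  have hp : (0 : ℝ) < P.card := by exact_mod_cast hP.card_pos
  have hR : (0 : ℝ) < R.card := by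
    obtain ⟨σ, hσ⟩ := hP
    exact_mod_cast Finset.card_pos.2 ⟨_, hf σ hσ⟩
  have hc : ∀ σ ∈ P, (0 : ℝ) < ((P.filter fun ρ => f ρ = f σ).card : ℝ) := fun σ hσ => by
    exact_mod_cast Finset.card_pos.2 ⟨σ, by simp [hσ]⟩
  have hpt : ∀ σ ∈ P, Real.log P.card - Real.log R.card
      - Real.log ((P.filter fun ρ => f ρ = f σ).card : ℝ) ≤
      P.card / R.card * (1 / ((P.filter fun ρ => f ρ = f σ).card : ℝ)) - 1 := fun σ hσ => by
    have h1 := hc σ hσ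
    rw [← Real.log_div hp.ne' hR.ne', ← Real.log_div (by positivity) h1.ne']
    have := Real.log_le_sub_one_of_pos
      (show (0 : ℝ) < P.card / R.card / ((P.filter fun ρ => f ρ = f σ).card : ℝ) by positivity)
    rwa [div_eq_mul_one_div (P.card / R.card : ℝ)] at this ⊢
  have hsum : ∑ σ ∈ P, (1 / ((P.filter fun ρ => f ρ = f σ).card : ℝ)) ≤ R.card := by
    rw [← Finset.sum_fiberwise_of_maps_to hf]
    calc _ ≤ ∑ j ∈ R, (1 : ℝ) := Finset.sum_le_sum fun j _ => ?_
      _ = R.card := by simp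
    have h2 : ∀ σ ∈ P.filter (fun σ => f σ = j),
        (1 / ((P.filter fun ρ => f ρ = f σ).card : ℝ)) =
          1 / ((P.filter fun ρ => f ρ = j).card : ℝ) := fun σ hσ => by
      rw [(Finset.mem_filter.1 hσ).2]
    rw [Finset.sum_congr rfl h2, Finset.sum_const, nsmul_eq_mul, mul_one_div]
    exact div_self_le_one _
  have htot := Finset.sum_le_sum hpt
  rw [Finset.sum_sub_distrib, Finset.sum_sub_distrib, Finset.sum_sub_distrib, ← Finset.mul_sum]
    at htot
  simp only [Finset.sum_const, nsmul_eq_mul, mul_one] at htot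
  have h3 : (P.card / R.card : ℝ) * ∑ σ ∈ P, (1 / ((P.filter fun ρ => f ρ = f σ).card : ℝ))
      ≤ P.card / R.card * R.card := mul_le_mul_of_nonneg_left hsum (by positivity)
  rw [div_mul_cancel₀ _ hR.ne'] at h3
  linarith

/-- For a permutation `σ` with `σ v ∈ A v`, double counting of the pairs `(i, v)`, `i ≠ v`, gives
the exponents in Bregman's bound after one row and one column have been deleted. -/
lemma sum_sum_erase_logFactRoot {α : Type*} [DecidableEq α] (A : α → Finset α) (I : Finset α)
    (σ : Equiv.Perm α) (hσ : ∀ v, σ v ∈ A v) :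
    ∑ i ∈ I, (Real.log (A i ∩ I.image σ).card +
      ∑ v ∈ I.erase i, logFactRoot (A v ∩ (I.image σ).erase (σ i)).card) =
      I.card * ∑ v ∈ I, logFactRoot (A v ∩ I.image σ).card := by
  have hswap : ∑ i ∈ I, ∑ v ∈ I.erase i, logFactRoot (A v ∩ (I.image σ).erase (σ i)).card =
      ∑ v ∈ I, ∑ i ∈ I.erase v, logFactRoot (A v ∩ (I.image σ).erase (σ i)).card := by
    refine Finset.sum_comm' fun x y => ?_
    simp only [Finset.mem_erase]
    tauto
  rw [Finset.sum_add_distrib, hswap, ← Finset.sum_add_distrib, Finset.mul_sum]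
  refine Finset.sum_congr rfl fun v hv => ?_
  set r := (A v ∩ I.image σ).card with hr
  have hmem : σ v ∈ A v ∩ I.image σ :=
    Finset.mem_inter.2 ⟨hσ v, Finset.mem_image_of_mem _ hv⟩
  have hr1 : 1 ≤ r := Finset.card_pos.2 ⟨_, hmem⟩
  have hterm : ∀ i ∈ I.erase v, logFactRoot (A v ∩ (I.image σ).erase (σ i)).card =
      if σ i ∈ A v then logFactRoot (r - 1) else logFactRoot r := fun i hi => by
    have hi' : σ i ∈ I.image σ := Finset.mem_image_of_mem _ (Finset.mem_of_mem_erase hi)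
    rw [Finset.inter_erase]
    split_ifs with h
    · rw [Finset.card_erase_of_mem (Finset.mem_inter.2 ⟨h, hi'⟩)]
    · rw [Finset.erase_eq_of_notMem (fun hc => h (Finset.mem_inter.1 hc).1)]
  have hcount : (I.filter fun i => σ i ∈ A v).card = r := by
    rw [hr, ← Finset.card_image_of_injective (I.filter fun i => σ i ∈ A v) σ.injective]
    congr 1
    ext x
    simp only [Finset.mem_image, Finset.mem_filter, Finset.mem_inter]
    constructor
    · rintro ⟨a, ⟨h1, h2⟩, rfl⟩
      exact ⟨h2, a, h1, rfl⟩
    · rintro ⟨h2, a, h1, rfl⟩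
      exact ⟨a, ⟨h1, h2⟩, rfl⟩
  have hall : ∑ i ∈ I, (if σ i ∈ A v then logFactRoot (r - 1) else logFactRoot r) =
      r * logFactRoot (r - 1) + ((I.card : ℝ) - r) * logFactRoot r := by
    rw [Finset.sum_ite, Finset.sum_const, Finset.sum_const, hcount, nsmul_eq_mul, nsmul_eq_mul]
    have := Finset.card_filter_add_card_filter_not (s := I) (fun i => σ i ∈ A v)
    rw [hcount] at this
    have h' : (((I.filter fun i => σ i ∉ A v).card : ℕ) : ℝ) = I.card - r := by
      rw [← this]; push_cast; ring
    rw [h']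
  rw [Finset.sum_congr rfl hterm]
  rw [← Finset.add_sum_erase I _ hv, if_pos (hσ v)] at hall
  have hrec := log_add_pred_mul_logFactRoot hr1
  linear_combination hall + hrec

section Bregman

variable {α : Type*} [Fintype α] [DecidableEq α]

/-- The permutations `σ` with `σ v ∈ A v` for all `v` that agree with `τ` off `I`. Fixing `σ`
off `I` plays the role of deleting rows and columns of a matrix. -/
def restrictedPerms (A : α → Finset α) (I : Finset α) (τ : Equiv.Perm α) :
    Finset (Equiv.Perm α) :=
  Finset.univ.filter fun σ => (∀ v, σ v ∈ A v) ∧ ∀ v, v ∉ I → σ v = τ v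

lemma mem_restrictedPerms {A : α → Finset α} {I : Finset α} {τ σ : Equiv.Perm α} :
    σ ∈ restrictedPerms A I τ ↔ (∀ v, σ v ∈ A v) ∧ ∀ v, v ∉ I → σ v = τ v := by
  simp [restrictedPerms]

lemma image_eq_of_mem_restrictedPerms {A : α → Finset α} {I : Finset α} {τ σ : Equiv.Perm α}
    (h : σ ∈ restrictedPerms A I τ) : I.image σ = I.image τ := by
  rw [mem_restrictedPerms] at h
  have h1 : ∀ ρ : Equiv.Perm α, I.image ρ = (Iᶜ.image ρ)ᶜ := by
    intro ρ
    ext x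
    simp only [Finset.mem_image, Finset.mem_compl, not_exists, not_and]
    constructor
    · rintro ⟨a, ha, rfl⟩ b hb hab
      exact hb (ρ.injective hab ▸ ha)
    · intro hx
      refine ⟨ρ.symm x, ?_, by simp⟩
      by_contra hc
      exact hx _ hc (by simp)
  rw [h1 σ, h1 τ]
  congr 1
  exact Finset.image_congr fun v hv => h.2 v (by simpa using hv)

lemma filter_restrictedPerms {A : α → Finset α} {I : Finset α} {τ σ : Equiv.Perm α}
    (h : σ ∈ restrictedPerms A I τ) (i : α) :
    (restrictedPerms A I τ).filter (fun ρ => ρ i = σ i) = restrictedPerms A (I.erase i) σ := by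
  ext ρ
  rw [mem_restrictedPerms] at h
  simp only [Finset.mem_filter, mem_restrictedPerms, Finset.mem_erase, not_and]
  constructor
  · rintro ⟨⟨h1, h2⟩, h3⟩
    refine ⟨h1, fun v hv => ?_⟩
    by_cases hvi : v = i
    · rw [hvi, h3]
    · rw [h2 v (hv hvi), h.2 v (hv hvi)]
  · rintro ⟨h1, h2⟩
    refine ⟨⟨h1, fun v hv => ?_⟩, h2 i (fun h => absurd rfl h)⟩
    rw [h2 v (fun _ => hv), h.2 v hv]

/-- Schrijver's induction: the averaging step is applied at every point of `I`, and the results are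
added up, so that each point of `I` is removed in turn. -/
lemma log_card_restrictedPerms_le (A : α → Finset α) : ∀ (k : ℕ) (I : Finset α), I.card = k →
    ∀ τ : Equiv.Perm α, Real.log (restrictedPerms A I τ).card ≤
      ∑ v ∈ I, logFactRoot (A v ∩ I.image τ).card := by
  intro k
  induction k with
  | zero =>
    intro I hI τ
    rw [Finset.card_eq_zero] at hI
    subst hI
    have : (restrictedPerms A ∅ τ).card ≤ 1 := Finset.card_le_one.2 fun σ hσ ρ hρ => by
      rw [mem_restrictedPerms] at hσ hρ
      ext v
      rw [hσ.2 v (by simp), hρ.2 v (by simp)]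
    simp only [Finset.sum_empty]
    exact Real.log_nonpos (by positivity) (by exact_mod_cast this)
  | succ k ih =>
    intro I hI τ
    set P := restrictedPerms A I τ with hPdef
    rcases P.eq_empty_or_nonempty with hP | hP
    · rw [hP]
      simp only [Finset.card_empty, Nat.cast_zero, Real.log_zero]
      exact Finset.sum_nonneg fun v _ =>
        div_nonneg (Real.log_natCast_nonneg _) (Nat.cast_nonneg _)
    have hp : (0 : ℝ) < P.card := by exact_mod_cast hP.card_pos
    have hI0 : (0 : ℝ) < I.card := by rw [hI]; positivity
    have hstep : ∀ i ∈ I, (P.card : ℝ) * Real.log P.card ≤ ∑ σ ∈ P,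
        (Real.log (A i ∩ I.image σ).card +
          ∑ v ∈ I.erase i, logFactRoot (A v ∩ (I.image σ).erase (σ i)).card) := fun i hi => by
      have h1 := card_mul_log_card_le P (fun σ => σ i) (A i ∩ I.image τ) fun σ hσ => by
        rw [← image_eq_of_mem_restrictedPerms hσ]
        exact Finset.mem_inter.2
          ⟨(mem_restrictedPerms.1 hσ).1 i, Finset.mem_image_of_mem _ hi⟩
      refine h1.trans ?_
      rw [Finset.sum_add_distrib]
      refine add_le_add (le_of_eq ?_) (Finset.sum_le_sum fun σ hσ => ?_)
      · rw [← nsmul_eq_mul, ← Finset.sum_const]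
        exact Finset.sum_congr rfl fun σ hσ => by rw [image_eq_of_mem_restrictedPerms hσ]
      · rw [filter_restrictedPerms hσ]
        have := ih (I.erase i) (by rw [Finset.card_erase_of_mem hi, hI]; rfl) σ
        rwa [Finset.image_erase σ.injective] at this
    have hsum := Finset.sum_le_sum hstep
    rw [Finset.sum_const, nsmul_eq_mul, Finset.sum_comm] at hsum
    have hconst : ∀ σ ∈ P, ∑ i ∈ I, (Real.log (A i ∩ I.image σ).card +
        ∑ v ∈ I.erase i, logFactRoot (A v ∩ (I.image σ).erase (σ i)).card) =
        I.card * ∑ v ∈ I, logFactRoot (A v ∩ I.image τ).card := fun σ hσ => by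
      rw [sum_sum_erase_logFactRoot A I σ (mem_restrictedPerms.1 hσ).1,
        image_eq_of_mem_restrictedPerms hσ]
    rw [Finset.sum_congr rfl hconst, Finset.sum_const, nsmul_eq_mul] at hsum
    have : (I.card * P.card : ℝ) * Real.log P.card ≤
        (I.card * P.card : ℝ) * ∑ v ∈ I, logFactRoot (A v ∩ I.image τ).card := by linarith
    exact le_of_mul_le_mul_left this (by positivity)

/-- **Bregman's theorem**: the number of permutations `σ` with `σ v ∈ A v` for all `v` is at most
`∏ v, (|A v|!)^(1/|A v|)`. -/
theorem card_perm_le_exp (A : α → Finset α) :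
    ((Finset.univ.filter fun σ : Equiv.Perm α => ∀ v, σ v ∈ A v).card : ℝ) ≤
      Real.exp (∑ v, logFactRoot (A v).card) := by
  have h := log_card_restrictedPerms_le A _ Finset.univ rfl 1
  have h1 : restrictedPerms A Finset.univ 1 =
      Finset.univ.filter fun σ : Equiv.Perm α => ∀ v, σ v ∈ A v := by
    ext; simp [restrictedPerms]
  have h2 : (Finset.univ : Finset α).image (1 : Equiv.Perm α) = Finset.univ := by simp
  rw [h1, h2] at h
  simp only [Finset.inter_univ] at h
  exact (Real.le_exp_log _).trans (Real.exp_le_exp.2 h)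

end Bregman

/-- A form of Stirling's upper bound; the constant `19/20` replaces `1`. -/
lemma log_factorial_pred_le {r : ℕ} (hr : 41 ≤ r) :
    Real.log ((r - 1).factorial : ℝ) ≤ ((r : ℝ) - 1) * (Real.log r - 19 / 20) := by
  induction r, hr using Nat.le_induction with
  | base =>
    have h : (((41 - 1 : ℕ).factorial : ℝ)) ≤ 41 ^ 40 / Real.exp 1 ^ 38 := by
      have he : Real.exp 1 ^ 38 ≤ 2.7182818286 ^ 38 :=
        pow_le_pow_left₀ (Real.exp_pos _).le Real.exp_one_lt_d9.le _
      rw [le_div_iff₀ (by positivity)]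
      refine (mul_le_mul_of_nonneg_left he (by positivity)).trans ?_
      norm_num [Nat.factorial]
    have h2 := Real.log_le_log (by positivity) h
    rw [Real.log_div (by positivity) (by positivity), Real.log_pow, Real.log_pow,
      Real.log_exp] at h2
    refine h2.trans (le_of_eq ?_)
    push_cast
    ring
  | succ r hr ih =>
    obtain ⟨k, rfl⟩ := Nat.exists_eq_add_of_le' (show 1 ≤ r by omega)
    simp only [Nat.add_sub_cancel] at ih ⊢
    set x : ℝ := ((k + 1 : ℕ) : ℝ) with hx
    have hx41 : (41 : ℝ) ≤ x := by rw [hx]; exact_mod_cast hr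
    have hx0 : 0 < x := by linarith
    rw [Nat.factorial_succ, Nat.cast_mul, Real.log_mul (by positivity) (by positivity), ← hx]
    have hcast : (((k + 1 + 1 : ℕ) : ℝ)) = x + 1 := by rw [hx]; push_cast; ring
    rw [hcast]
    -- `x log (1 + 1/x) ≥ x/(x+1) ≥ 41/42`.
    have hlog : 19 / 20 ≤ x * (Real.log (x + 1) - Real.log x) := by
      have h1 := Real.one_sub_inv_le_log_of_pos (show 0 < (x + 1) / x by positivity)
      rw [Real.log_div (by positivity) hx0.ne'] at h1
      have h2 : x * (1 - ((x + 1) / x)⁻¹) = 1 - 1 / (x + 1) := by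
        field_simp
        ring
      have h3 : 1 / (x + 1) ≤ 1 / 42 := one_div_le_one_div_of_le (by norm_num) (by linarith)
      have h4 := mul_le_mul_of_nonneg_left h1 hx0.le
      linarith
    nlinarith

lemma logFactRoot_step {r : ℕ} (hr : 41 ≤ r) :
    19 / 20 / (r : ℝ) ≤ logFactRoot r - logFactRoot (r - 1) := by
  have h := log_factorial_pred_le hr
  have h1 := log_add_pred_mul_logFactRoot (show 1 ≤ r by omega)
  have h2 := mul_logFactRoot (r - 1)
  rw [Nat.cast_sub (show 1 ≤ r by omega), Nat.cast_one] at h2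
  have hr' : (41 : ℝ) ≤ r := by exact_mod_cast hr
  rw [div_le_iff₀ (by linarith)]
  have hpos : (0 : ℝ) < r - 1 := by linarith
  rw [← h2] at h
  have h3 := le_of_mul_le_mul_left h hpos
  linarith

lemma logFactRoot_sub_ge {N d : ℕ} (h : 41 + d ≤ N) :
    19 / 20 * (d : ℝ) / N ≤ logFactRoot N - logFactRoot (N - d) := by
  induction d with
  | zero => simp
  | succ d ih =>
    have h1 := ih (by omega)
    have h2 := logFactRoot_step (r := N - d) (by omega)
    have h3 : 19 / 20 / (N : ℝ) ≤ 19 / 20 / ((N - d : ℕ) : ℝ) := by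
      refine div_le_div_of_nonneg_left (by norm_num) ?_ ?_
      · exact_mod_cast (by omega : 0 < N - d)
      · exact_mod_cast Nat.sub_le N d
    rw [show N - d - 1 = N - (d + 1) by omega] at h2
    have h4 : 19 / 20 * ((d + 1 : ℕ) : ℝ) / N = 19 / 20 * (d : ℝ) / N + 19 / 20 / N := by
      push_cast; ring
    linarith

/-! ### Degrees in sets of edge tokens -/

section Degrees

variable {n : ℕ}

/-- The number of tokens in `F` incident with `v`. -/
def incDeg (F : Finset (EdgeToken n)) (v : Fin n) : ℕ := (F.filter fun e => v ∈ e.1).card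

/-- The neighbours of `v` in the graph with edge set `F`. -/
def nbrs (F : Finset (EdgeToken n)) (v : Fin n) : Finset (Fin n) :=
  Finset.univ.filter fun u => ∃ e ∈ F, e.1 = s(v, u)

lemma mem_nbrs {F : Finset (EdgeToken n)} {v u : Fin n} :
    u ∈ nbrs F v ↔ ∃ e ∈ F, e.1 = s(v, u) := by
  simp [nbrs]

lemma card_nbrs (F : Finset (EdgeToken n)) (v : Fin n) : (nbrs F v).card = incDeg F v := by
  have h : (nbrs F v).image (fun u => s(v, u)) =
      (F.filter fun e => v ∈ e.1).image Subtype.val := by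
    ext x
    simp only [Finset.mem_image, mem_nbrs, Finset.mem_filter]
    constructor
    · rintro ⟨u, ⟨e, he, heq⟩, rfl⟩
      exact ⟨e, ⟨he, by rw [heq]; exact Sym2.mem_mk_left _ _⟩, heq⟩
    · rintro ⟨e, ⟨he, hv⟩, rfl⟩
      obtain ⟨u, hu⟩ := hv
      exact ⟨u, ⟨e, he, hu⟩, hu.symm⟩
  rw [incDeg, ← Finset.card_image_of_injective _ Subtype.val_injective, ← h,
    Finset.card_image_of_injective]
  intro a b hab
  exact Sym2.congr_right.1 hab

lemma sum_incDeg (F : Finset (EdgeToken n)) : ∑ v, incDeg F v = 2 * F.card := by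
  simp only [incDeg, Finset.card_filter]
  rw [Finset.sum_comm]
  have : ∀ e ∈ F, ∑ v : Fin n, (if v ∈ e.1 then 1 else 0) = 2 := fun e _ => by
    rw [← Finset.card_filter, ← Sym2.card_toFinset_of_not_isDiag e.1 e.2]
    congr 1
    ext v
    simp
  rw [Finset.sum_congr rfl this, Finset.sum_const, smul_eq_mul, mul_comm]

lemma incDeg_union_le (F G : Finset (EdgeToken n)) (v : Fin n) :
    incDeg (F ∪ G) v ≤ incDeg F v + incDeg G v := by
  rw [incDeg, Finset.filter_union]
  exact Finset.card_union_le _ _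

lemma streamGraph_adj {σ : List (EdgeToken n)} {u v : Fin n} :
    (streamGraph σ).Adj u v ↔ ∃ e ∈ σ, e.1 = s(u, v) := by
  simp only [streamGraph, SimpleGraph.fromEdgeSet_adj, Set.mem_ofPred_eq, List.mem_map]
  constructor
  · exact fun h => h.1
  · rintro ⟨e, he, heq⟩
    refine ⟨⟨e, he, heq⟩, fun huv => e.2 ?_⟩
    rw [heq, huv]
    exact Sym2.mk_isDiag_iff.2 rfl

lemma ncard_neighborSet_streamGraph (σ : List (EdgeToken n)) (v : Fin n) :
    ((streamGraph σ).neighborSet v).ncard = incDeg σ.toFinset v := by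
  rw [← card_nbrs, ← Set.ncard_coe_finset]
  congr 1
  ext u
  simp [mem_nbrs, streamGraph_adj]

lemma length_le_of_incDeg_le {σ : List (EdgeToken n)} {L : ℕ} (hσ : σ.Nodup)
    (h : ∀ v, incDeg σ.toFinset v ≤ L) : σ.length ≤ n * L / 2 := by
  rw [Nat.le_div_iff_mul_le (by norm_num), mul_comm, ← List.toFinset_card_of_nodup hσ,
    ← sum_incDeg]
  exact (Finset.sum_le_sum fun v _ => h v).trans (by simp)

end Degrees

/-! ### Adversaries that react to the last answer -/

/-- An adversary sees all earlier answers, so it can recompute its own earlier tokens; hence it may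
as well choose each token from the stream so far and the last answer. -/
lemma exists_next {U Z : Type} [Nonempty U] {s r : ℕ} (A : StreamAlg U Z s r)
    (strat : List U → Z → U) : ∃ next : List Z → U, ∀ R i,
      A.advStream next R (i + 1) = A.advStream next R i ++
        [strat (A.advStream next R i) (A.output R (A.advStream next R i))] := by
  classical
  obtain ⟨u₀⟩ := ‹Nonempty U›
  let hist : List Z → List U := fun zs => zs.foldl (fun I z => I ++ [strat I z]) []
  let next : List Z → U := fun zs => (hist zs).getLastD u₀
  refine ⟨next, fun R => ?_⟩
  have hinits : ∀ (l : List U) (x : U), (l ++ [x]).inits = l.inits ++ [l ++ [x]] := fun l x => by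
    rw [List.inits_append]; simp
  have hsnoc : ∀ (zs : List Z) (z : Z), hist (zs ++ [z]) = hist zs ++ [strat (hist zs) z] :=
    fun zs z => by simp [hist, List.foldl_append]
  have key : ∀ i, hist ((A.advStream next R i).inits.map (A.output R)) =
      A.advStream next R i ++
        [strat (A.advStream next R i) (A.output R (A.advStream next R i))] ∧
      A.advStream next R (i + 1) = A.advStream next R i ++
        [strat (A.advStream next R i) (A.output R (A.advStream next R i))] := by
    intro i
    induction i with
    | zero => simp [StreamAlg.advStream, hist, next]
    | succ i ih =>
      have h1 : hist ((A.advStream next R (i + 1)).inits.map (A.output R)) =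
          A.advStream next R (i + 1) ++ [strat (A.advStream next R (i + 1))
            (A.output R (A.advStream next R (i + 1)))] := by
        conv_lhs => rw [ih.2, hinits, List.map_append, List.map_singleton, hsnoc, ih.1]
        rw [← ih.2]
      refine ⟨h1, ?_⟩
      conv_lhs => rw [StreamAlg.advStream]
      simp only [next, h1]
      simp
  exact fun i => (key i).2

lemma output_append {U Z : Type} {s r : ℕ} (A : StreamAlg U Z s r) (R : Fin r → Bool)
    (S I : List U) :
    A.output R (S ++ I) = A.query (I.foldl (fun w x => A.process w x R) (A.state R S)) R := by
  simp [StreamAlg.output, StreamAlg.state, List.foldl_append]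

/-! ### Probing the memory state with monochromatic edges -/

section Probe

variable {n K s r : ℕ} {ι : Type}

/-- The tokens with which the adversary may continue after its probing edges `I`, when the last
answer is `z`: both ends lie in the same block of `β`, have the same color, and have degree less
than `d` in the probing graph. -/
def IsProbeEdge (β : Fin n → ι) (d : ℕ) (I : List (EdgeToken n)) (z : Fin n → Fin K)
    (e : EdgeToken n) : Prop :=
  (∀ u ∈ e.1, ∀ v ∈ e.1, β u = β v ∧ z u = z v) ∧ ∀ v ∈ e.1, incDeg I.toFinset v < d

open Classical in
/-- A choice of a probing edge, if there is any. -/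
noncomputable def probeEdge (β : Fin n → ι) (d : ℕ) (I : List (EdgeToken n))
    (z : Fin n → Fin K) : Option (EdgeToken n) :=
  if h : ∃ e, IsProbeEdge β d I z e then some h.choose else none

lemma isProbeEdge_of_probeEdge_eq_some {β : Fin n → ι} {d : ℕ} {I : List (EdgeToken n)}
    {z : Fin n → Fin K} {e : EdgeToken n} (h : probeEdge β d I z = some e) :
    IsProbeEdge β d I z e := by
  unfold probeEdge at h
  split_ifs at h with h'
  rw [← Option.some.inj h]
  exact h'.choose_spec

lemma not_isProbeEdge_of_probeEdge_eq_none {β : Fin n → ι} {d : ℕ} {I : List (EdgeToken n)}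
    {z : Fin n → Fin K} (h : probeEdge β d I z = none) (e : EdgeToken n) :
    ¬ IsProbeEdge β d I z e := by
  unfold probeEdge at h
  split_ifs at h with h'
  exact fun he => h' ⟨e, he⟩

/-- The first `k` probing edges (or all of them, if there are fewer) inserted after the memory
state `w` has been reached. They depend only on `w` and on the random string, not on the stream
that led to `w`. -/
noncomputable def probes (A : StreamAlg (EdgeToken n) (Fin n → Fin K) s r) (β : Fin n → ι) (d : ℕ)
    (R : Fin r → Bool) (w : Fin s → Bool) : ℕ → List (EdgeToken n)
  | 0 => []
  | k + 1 => probes A β d R w k ++ (probeEdge β d (probes A β d R w k)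
      (A.query ((probes A β d R w k).foldl (fun w x => A.process w x R) w) R)).toList

lemma probes_length_or_none (A : StreamAlg (EdgeToken n) (Fin n → Fin K) s r) (β : Fin n → ι)
    (d : ℕ) (R : Fin r → Bool) (w : Fin s → Bool) (k : ℕ) :
    (probes A β d R w k).length = k ∨ probeEdge β d (probes A β d R w k)
      (A.query ((probes A β d R w k).foldl (fun w x => A.process w x R) w) R) = none := by
  induction k with
  | zero => simp [probes]
  | succ k ih =>
    rcases hp : probeEdge β d (probes A β d R w k)
      (A.query ((probes A β d R w k).foldl (fun w x => A.process w x R) w) R) with _ | e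
    · right
      have : probes A β d R w (k + 1) = probes A β d R w k := by
        rw [probes, hp]; simp
      rw [this, hp]
    · left
      rw [hp] at ih
      rw [probes, hp]
      simpa using ih

lemma block_eq_of_mem_probes (A : StreamAlg (EdgeToken n) (Fin n → Fin K) s r) (β : Fin n → ι)
    (d : ℕ) (R : Fin r → Bool) (w : Fin s → Bool) (k : ℕ) :
    ∀ e ∈ probes A β d R w k, ∀ u ∈ e.1, ∀ v ∈ e.1, β u = β v := by
  induction k with
  | zero => simp [probes]
  | succ k ih =>
    intro e he
    rw [probes, List.mem_append, Option.mem_toList] at he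
    rcases he with he | he
    · exact ih e he
    · exact fun u hu v hv => ((isProbeEdge_of_probeEdge_eq_some he).1 u hu v hv).1

/-- The adversary that inserts the list `S` first and probing edges afterwards. -/
noncomputable def probeStrategy (β : Fin n → ι) (d : ℕ) (S : List (EdgeToken n)) (e₀ : EdgeToken n)
    (I : List (EdgeToken n)) (z : Fin n → Fin K) : EdgeToken n :=
  if h : I.length < S.length then S[I.length] else (probeEdge β d (I.drop S.length) z).getD e₀

/-- Against a correct run, the probing edges are new edges and the degree bound is kept. -/
lemma probes_spec {A : StreamAlg (EdgeToken n) (Fin n → Fin K) s r} {β : Fin n → ι} {d₁ d L m : ℕ}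
    {S : List (EdgeToken n)} {e₀ : EdgeToken n} {R : Fin r → Bool}
    {next : List (Fin n → Fin K) → EdgeToken n}
    (hS : S.Nodup) (hdeg : ∀ v, incDeg S.toFinset v ≤ d₁) (hL : d₁ + d ≤ L) (hm : n * L / 2 ≤ m)
    (hnext : ∀ i, A.advStream next R (i + 1) = A.advStream next R i ++
      [probeStrategy β d S e₀ (A.advStream next R i) (A.output R (A.advStream next R i))])
    (hgood : ∀ i, 1 ≤ i → i ≤ m → ColoringProblem n L K (A.advStream next R i)
      (A.output R (A.advStream next R i))) (k : ℕ) :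
    (S ++ probes A β d R (A.state R S) k).Nodup ∧
    (∀ v, incDeg (probes A β d R (A.state R S) k).toFinset v ≤ d) ∧
    A.advStream next R (S.length + (probes A β d R (A.state R S) k).length) =
      S ++ probes A β d R (A.state R S) k := by
  induction k with
  | zero =>
    refine ⟨by simpa [probes] using hS, by simp [probes, incDeg], ?_⟩
    have htake : ∀ i, i ≤ S.length → A.advStream next R i = S.take i := by
      intro i
      induction i with
      | zero => simp [StreamAlg.advStream]
      | succ i ih =>
        intro hi
        have hlen : (S.take i).length = i := by simp; omega
        rw [hnext, ih (by omega), probeStrategy, dif_pos (by omega)]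
        simp only [hlen]
        exact List.take_concat_get' S i (by omega)
    simpa [probes] using htake S.length le_rfl
  | succ k ih =>
    obtain ⟨h1, h2, h3⟩ := ih
    rw [probes]
    set I := probes A β d R (A.state R S) k with hI
    rw [← output_append]
    rcases hp : probeEdge β d I (A.output R (S ++ I)) with _ | e
    · simpa using ⟨h1, h2, h3⟩
    have hdegL : ∀ v, incDeg (S ++ I).toFinset v ≤ L := fun v => by
      rw [List.toFinset_append]
      exact (incDeg_union_le _ _ _).trans ((add_le_add (hdeg v) (h2 v)).trans hL)
    obtain ⟨hmono, hlt⟩ := isProbeEdge_of_probeEdge_eq_some hp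
    -- The answer to the empty stream may be wrong, but then there is no old edge to be hit.
    have hnew : e ∉ S ++ I := by
      intro he
      have hlen := length_le_of_incDeg_le h1 hdegL
      have hpos : 1 ≤ (S ++ I).length := List.length_pos_of_mem he
      rw [List.length_append] at hlen hpos
      have hcol := hgood (S.length + I.length) hpos (hlen.trans hm)
      rw [h3] at hcol
      obtain ⟨⟨u, v⟩, huv⟩ := Quot.exists_rep e.1
      have huv' : e.1 = s(u, v) := huv.symm
      refine hcol ⟨h1, fun v => by rw [ncard_neighborSet_streamGraph]; exact hdegL v⟩ u v
        (streamGraph_adj.2 ⟨e, he, huv'⟩) (hmono u ?_ v ?_).2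
      · rw [huv']; exact Sym2.mem_mk_left _ _
      · rw [huv']; exact Sym2.mem_mk_right _ _
    refine ⟨?_, fun v => ?_, ?_⟩
    · rw [Option.toList_some, ← List.append_assoc]
      exact List.nodup_append.2 ⟨h1, by simp, fun a ha b hb => by
        rw [List.mem_singleton.1 hb]; rintro rfl; exact hnew ha⟩
    · rw [Option.toList_some, List.toFinset_append]
      by_cases hv : v ∈ e.1
      · refine (incDeg_union_le _ _ _).trans ?_
        have : incDeg [e].toFinset v ≤ 1 :=
          (Finset.card_filter_le _ _).trans (by simp)
        have := hlt v hv
        omega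
      · refine le_trans (le_of_eq ?_) (h2 v)
        rw [incDeg, Finset.filter_union]
        simp [incDeg, Finset.filter_singleton, hv]
    · rw [Option.toList_some, List.length_append, List.length_singleton, ← add_assoc, hnext, h3,
        probeStrategy, dif_neg (by simp), List.drop_left, hp, Option.getD_some,
        List.append_assoc]

/-- Once no probing edge is left, the vertices of probing degree less than `d` in a block have
pairwise different colors. -/
lemma card_unsaturated_le [DecidableEq ι] {β : Fin n → ι} {d : ℕ} {I : List (EdgeToken n)}
    {z : Fin n → Fin K} (h : probeEdge β d I z = none) (j : ι) :
    (Finset.univ.filter fun v => β v = j ∧ incDeg I.toFinset v < d).card ≤ K := by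
  rw [← Fintype.card_fin K]
  refine Finset.card_le_card_of_injOn z (fun _ _ => Finset.mem_univ _) fun u hu v hv huv => ?_
  simp only [Finset.coe_filter, Finset.mem_univ, true_and, Set.mem_ofPred_eq] at hu hv
  by_contra hne
  refine not_isProbeEdge_of_probeEdge_eq_none h ⟨s(u, v), fun hd => hne (Sym2.mk_isDiag_iff.1 hd)⟩
    ⟨fun a ha b hb => ?_, fun a ha => ?_⟩
  · rcases Sym2.mem_iff.1 ha with rfl | rfl <;> rcases Sym2.mem_iff.1 hb with rfl | rfl <;>
      simp [hu.1, hv.1, huv]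
  · rcases Sym2.mem_iff.1 ha with rfl | rfl
    exacts [hu.2, hv.2]

end Probe

/-! ### Unions of block-preserving permutations -/

section Blocks

variable {n : ℕ} {ι : Type} [Fintype ι] [DecidableEq ι]

/-- The block of `β` with label `j`. -/
def block (β : Fin n → ι) (j : ι) : Finset (Fin n) := Finset.univ.filter fun v => β v = j

/-- The permutations that map each block of `β` to itself. -/
def blockPerms (β : Fin n → ι) : Finset (Equiv.Perm (Fin n)) :=
  Finset.univ.filter fun σ => ∀ v, β (σ v) = β v

lemma card_blockPerms (β : Fin n → ι) :
    ((blockPerms β).card : ℝ) = Real.exp (∑ v, logFactRoot (block β (β v)).card) := by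
  have h1 : (blockPerms β).card = ∏ j, ((block β j).card).factorial := by
    rw [blockPerms, ← Fintype.card_subtype]
    have := DomMulAct.stabilizer_card β
    simp only [Fintype.card_subtype, funext_iff, Function.comp_apply] at this
    rw [Fintype.card_subtype, this]
    rfl
  have h2 : ∑ v, logFactRoot (block β (β v)).card =
      ∑ j, Real.log ((block β j).card.factorial : ℝ) := by
    rw [← Finset.sum_fiberwise Finset.univ β]
    refine Finset.sum_congr rfl fun j _ => ?_
    rw [Finset.sum_congr rfl (g := fun _ => logFactRoot (block β j).card)
      fun v hv => by rw [(Finset.mem_filter.1 hv).2], Finset.sum_const, nsmul_eq_mul]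
    exact mul_logFactRoot _
  rw [h2, Real.exp_sum, h1, Nat.cast_prod]
  exact Finset.prod_congr rfl fun j _ => (Real.exp_log (by positivity)).symm

/-- The block-preserving permutations `σ` none of whose pairs `{v, σ v}` is an edge of `B`.
Fixed points are unrestricted, so for empty `B` all of `blockPerms β` qualify and Bregman's bound is
exact. -/
def avoidingPerms (β : Fin n → ι) (B : Finset (EdgeToken n)) : Finset (Equiv.Perm (Fin n)) :=
  (blockPerms β).filter fun σ => ∀ e ∈ B, ∀ v, e.1 ≠ s(v, σ v)

/-- Bregman's bound, applied to the permutations avoiding a set `B` of edges inside blocks that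
saturates all but `K` vertices of each block. -/
lemma card_avoidingPerms_le {β : Fin n → ι} {B : Finset (EdgeToken n)} {d K M : ℕ}
    (hB : ∀ e ∈ B, ∀ u ∈ e.1, ∀ v ∈ e.1, β u = β v) (hd : ∀ v, incDeg B v ≤ d)
    (hM : ∀ j, M ≤ (block β j).card) (hdM : 41 + d ≤ M)
    (hK : ∀ j, (Finset.univ.filter fun v => β v = j ∧ incDeg B v < d).card ≤ K) :
    ((avoidingPerms β B).card : ℝ) ≤ (blockPerms β).card *
      Real.exp (-(19 / 20 * d * Fintype.card ι * (1 - K / M))) := by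
  have hsub : avoidingPerms β B ⊆ Finset.univ.filter fun σ : Equiv.Perm (Fin n) =>
      ∀ v, σ v ∈ block β (β v) \ nbrs B v := by
    intro σ hσ
    simp only [avoidingPerms, blockPerms, Finset.mem_filter, Finset.mem_univ, true_and] at hσ
    simp only [block, Finset.mem_filter, Finset.mem_univ, true_and, Finset.mem_sdiff, mem_nbrs]
    exact fun v => ⟨hσ.1 v, fun ⟨e, he, h⟩ => hσ.2 e he v h⟩
  have hcard : ∀ v, (block β (β v) \ nbrs B v).card = (block β (β v)).card - incDeg B v := by
    intro v
    rw [Finset.card_sdiff_of_subset, card_nbrs]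
    intro u hu
    obtain ⟨e, he, heq⟩ := mem_nbrs.1 hu
    simp only [block, Finset.mem_filter, Finset.mem_univ, true_and]
    exact hB e he u (by rw [heq]; exact Sym2.mem_mk_right _ _) v
      (by rw [heq]; exact Sym2.mem_mk_left _ _)
  have h1 : ((avoidingPerms β B).card : ℝ) ≤
      Real.exp (∑ v, logFactRoot ((block β (β v)).card - incDeg B v)) := by
    refine le_trans ?_ ((card_perm_le_exp fun v => block β (β v) \ nbrs B v).trans
      (le_of_eq ?_))
    · exact Nat.cast_le.2 (Finset.card_le_card (by convert hsub))
    · simp only [hcard]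
  refine h1.trans ?_
  rw [card_blockPerms, ← Real.exp_add, Real.exp_le_exp]
  have h2 : ∑ v, 19 / 20 * (incDeg B v : ℝ) / (block β (β v)).card ≤
      ∑ v, (logFactRoot (block β (β v)).card -
        logFactRoot ((block β (β v)).card - incDeg B v)) :=
    Finset.sum_le_sum fun v _ => logFactRoot_sub_ge (by have := hM (β v); have := hd v; omega)
  rw [Finset.sum_sub_distrib] at h2
  have h3 : 19 / 20 * d * Fintype.card ι * (1 - K / M : ℝ) ≤
      ∑ v, 19 / 20 * (incDeg B v : ℝ) / (block β (β v)).card := by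
    rw [← Finset.sum_fiberwise Finset.univ β]
    calc 19 / 20 * d * Fintype.card ι * (1 - K / M : ℝ)
        = ∑ j : ι, (19 / 20 * d * (1 - K / M : ℝ)) := by
          rw [Finset.sum_const, nsmul_eq_mul, Finset.card_univ]; ring
      _ ≤ _ := Finset.sum_le_sum fun j _ => ?_
    have hMpos : (0 : ℝ) < M := by exact_mod_cast (by omega : 0 < M)
    have hNM : (M : ℝ) ≤ (block β j).card := by exact_mod_cast hM j
    set N : ℝ := ((block β j).card : ℝ) with hN
    have hNpos : 0 < N := hMpos.trans_le hNM
    rw [Finset.sum_congr rfl (g := fun v => 19 / 20 / N * (incDeg B v : ℝ))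
      fun v hv => by rw [(Finset.mem_filter.1 hv).2, ← hN]; ring, ← Finset.mul_sum]
    have hdeg : (d : ℝ) * (N - K) ≤ ∑ v ∈ Finset.univ.filter (fun v => β v = j),
        (incDeg B v : ℝ) := by
      have hs : ∑ v ∈ Finset.univ.filter (fun v => β v = j),
          ((d : ℝ) * (1 - if incDeg B v < d then 1 else 0)) ≤
          ∑ v ∈ Finset.univ.filter (fun v => β v = j), (incDeg B v : ℝ) := by
        refine Finset.sum_le_sum fun v _ => ?_
        split_ifs with h
        · simp
        · simpa using not_lt.1 h
      refine le_trans ?_ hs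
      rw [← Finset.mul_sum, Finset.sum_sub_distrib, Finset.sum_boole, Finset.filter_filter]
      refine mul_le_mul_of_nonneg_left ?_ (Nat.cast_nonneg d)
      have hKj : (((Finset.univ.filter fun v => β v = j ∧ incDeg B v < d).card : ℕ) : ℝ) ≤ K := by
        exact_mod_cast hK j
      have : ∑ v ∈ Finset.univ.filter (fun v => β v = j), (1 : ℝ) = N := by
        simp [hN, block]
      linarith
    have hKM : (K : ℝ) / N ≤ K / M :=
      div_le_div_of_nonneg_left (Nat.cast_nonneg K) hMpos hNM
    calc 19 / 20 * d * (1 - K / M : ℝ) ≤ 19 / 20 * d * (1 - K / N : ℝ) := by gcongr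
      _ = 19 / 20 / N * (d * (N - K)) := by field_simp
      _ ≤ _ := mul_le_mul_of_nonneg_left hdeg (by positivity)
  linarith

/-- The graph formed by the pairs `{v, ω h v}`; fixed points contribute nothing. -/
def permEdges {l : ℕ} (ω : Fin l → Equiv.Perm (Fin n)) : Finset (EdgeToken n) :=
  Finset.univ.filter fun e => ∃ h v, e.1 = s(v, ω h v)

lemma incDeg_permEdges_le {l : ℕ} (ω : Fin l → Equiv.Perm (Fin n)) (v : Fin n) :
    incDeg (permEdges ω) v ≤ 2 * l := by
  have hsub : nbrs (permEdges ω) v ⊆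
      Finset.univ.image (fun h => ω h v) ∪ Finset.univ.image (fun h => (ω h).symm v) := by
    intro u hu
    obtain ⟨e, he, heq⟩ := mem_nbrs.1 hu
    simp only [permEdges, Finset.mem_filter, Finset.mem_univ, true_and] at he
    obtain ⟨h, w, hw⟩ := he
    rw [heq] at hw
    simp only [Finset.mem_union, Finset.mem_image, Finset.mem_univ, true_and]
    rcases Sym2.eq_iff.1 hw with ⟨rfl, rfl⟩ | ⟨rfl, rfl⟩
    · exact Or.inl ⟨h, rfl⟩
    · exact Or.inr ⟨h, by simp⟩
  rw [← card_nbrs, two_mul]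
  refine (Finset.card_le_card hsub).trans ((Finset.card_union_le _ _).trans ?_)
  exact add_le_add (Finset.card_image_le.trans (by simp)) (Finset.card_image_le.trans (by simp))

end Blocks

/-! ### Counting the correct runs -/

section Counting

variable {n K s r : ℕ} {ι : Type} [Fintype ι] [DecidableEq ι]

/-- The number of families `ω` that lead to the memory state `w` and on which `A` is correct is at
most the number of families of permutations avoiding the probing edges found from `w`. -/
lemma card_correct_le {A : StreamAlg (EdgeToken n) (Fin n → Fin K) s r} {β : Fin n → ι}
    {l d L M m : ℕ} (hL : 2 * l + d ≤ L) (hm : n * L / 2 ≤ m)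
    (hM : ∀ j, M ≤ (block β j).card) (hdM : 41 + d ≤ M) {e₀ : EdgeToken n}
    {next : (Fin l → Equiv.Perm (Fin n)) → List (Fin n → Fin K) → EdgeToken n}
    (hnext : ∀ ω R i, A.advStream (next ω) R (i + 1) = A.advStream (next ω) R i ++
      [probeStrategy β d (permEdges ω).toList e₀ (A.advStream (next ω) R i)
        (A.output R (A.advStream (next ω) R i))])
    (R : Fin r → Bool) (w : Fin s → Bool) (G : Finset (Fin l → Equiv.Perm (Fin n)))
    (hG : ∀ ω ∈ G, ∀ h, ω h ∈ blockPerms β)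
    (hw : ∀ ω ∈ G, A.state R (permEdges ω).toList = w)
    (hgood : ∀ ω ∈ G, ∀ i, 1 ≤ i → i ≤ m → ColoringProblem n L K (A.advStream (next ω) R i)
      (A.output R (A.advStream (next ω) R i))) :
    (G.card : ℝ) ≤ ((blockPerms β).card *
      Real.exp (-(19 / 20 * d * Fintype.card ι * (1 - K / M)))) ^ l := by
  rcases G.eq_empty_or_nonempty with rfl | ⟨ω₀, hω₀⟩
  · simp only [Finset.card_empty, Nat.cast_zero]
    positivity
  have hspec : ∀ ω ∈ G, ∀ k,
      ((permEdges ω).toList ++ probes A β d R w k).Nodup ∧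
      ∀ v, incDeg (probes A β d R w k).toFinset v ≤ d := fun ω hω k => by
    have := probes_spec (permEdges ω).nodup_toList
      (fun v => by rw [Finset.toList_toFinset]; exact incDeg_permEdges_le ω v) hL hm
      (hnext ω R) (hgood ω hω) k
    rw [hw ω hω] at this
    exact ⟨this.1, this.2.1⟩
  -- A graph of maximum degree `d` has at most `n * d / 2` edges, so one more step stops probing.
  set I := probes A β d R w (n * d / 2 + 1) with hI
  obtain ⟨h1, h2⟩ := hspec ω₀ hω₀ (n * d / 2 + 1)
  have hnone := (probes_length_or_none A β d R w (n * d / 2 + 1)).resolve_left fun hlen => by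
    have := length_le_of_incDeg_le (List.nodup_append.1 h1).2.1 h2
    rw [hlen] at this
    omega
  have havoid := card_avoidingPerms_le (B := I.toFinset)
    (fun e he => block_eq_of_mem_probes A β d R w _ e (List.mem_toFinset.1 he)) h2 hM hdM
    (card_unsaturated_le hnone)
  have hsub : G ⊆ Fintype.piFinset fun _ => avoidingPerms β I.toFinset := by
    intro ω hω
    rw [Fintype.mem_piFinset]
    intro h
    refine Finset.mem_filter.2 ⟨hG ω hω h, fun e he v hev => ?_⟩
    refine (List.nodup_append.1 (hspec ω hω (n * d / 2 + 1)).1).2.2 e ?_ e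
      (List.mem_toFinset.1 he) rfl
    rw [Finset.mem_toList, permEdges, Finset.mem_filter]
    exact ⟨Finset.mem_univ _, h, v, hev⟩
  calc (G.card : ℝ) ≤ ((avoidingPerms β I.toFinset).card : ℝ) ^ l := by
        have := Finset.card_le_card hsub
        rw [Fintype.card_piFinset_const] at this
        exact_mod_cast this
    _ ≤ _ := pow_le_pow_left₀ (Nat.cast_nonneg _) havoid l

/-- Double counting of the pairs of a random string and a family of permutations on which `A` is
correct. -/
lemma quarter_le_of_isRobust {A : StreamAlg (EdgeToken n) (Fin n → Fin K) s r} {β : Fin n → ι}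
    {l d L M m : ℕ} (hL : 2 * l + d ≤ L) (hm : n * L / 2 ≤ m)
    (hM : ∀ j, M ≤ (block β j).card) (hdM : 41 + d ≤ M) [Nonempty (EdgeToken n)]
    (hA : A.IsRobust (ColoringProblem n L K) (3 / 4) m) :
    1 / 4 ≤ (2 : ℝ) ^ s * Real.exp (-(19 / 20 * d * Fintype.card ι * (1 - K / M))) ^ l := by
  classical
  obtain ⟨e₀⟩ := ‹Nonempty (EdgeToken n)›
  have : Nonempty (EdgeToken n) := ⟨e₀⟩
  choose next hnext using fun ω : Fin l → Equiv.Perm (Fin n) =>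
    exists_next A (probeStrategy β d (permEdges ω).toList e₀)
  let Good : (Fin l → Equiv.Perm (Fin n)) → (Fin r → Bool) → Prop := fun ω R =>
    ∀ i, 1 ≤ i → i ≤ m → ColoringProblem n L K (A.advStream (next ω) R i)
      (A.output R (A.advStream (next ω) R i))
  let Ω : Finset (Fin l → Equiv.Perm (Fin n)) := Fintype.piFinset fun _ => blockPerms β
  have hP : (0 : ℝ) < (blockPerms β).card := by rw [card_blockPerms]; positivity
  have hΩ : (Ω.card : ℝ) = ((blockPerms β).card : ℝ) ^ l := by
    simp only [Ω, Fintype.card_piFinset_const]; push_cast; rfl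
  set P : ℝ := ((blockPerms β).card : ℝ) with hPdef
  set x : ℝ := Real.exp (-(19 / 20 * d * Fintype.card ι * (1 - K / M))) with hx
  have hlow : ∀ ω, (2 : ℝ) ^ r / 4 ≤ ((Finset.univ.filter fun R => Good ω R).card : ℝ) := by
    intro ω
    have h := hA (next ω)
    rw [coinProb, le_div_iff₀ (by positivity)] at h
    have heq : {R | Good ω R}.ncard = (Finset.univ.filter fun R => Good ω R).card := by
      rw [← Set.ncard_coe_finset]; simp
    rw [← heq]
    refine le_trans (le_of_eq ?_) h
    ring
  have hup : ∀ R, ((Ω.filter fun ω => Good ω R).card : ℝ) ≤ 2 ^ s * (P * x) ^ l := by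
    intro R
    rw [Finset.card_eq_sum_card_fiberwise (f := fun ω => A.state R (permEdges ω).toList)
      (t := Finset.univ) (fun _ _ => Finset.mem_univ _), Nat.cast_sum]
    refine (Finset.sum_le_sum (g := fun _ => (P * x) ^ l) fun w _ => ?_).trans ?_
    · refine card_correct_le hL hm hM hdM hnext R w _ ?_ ?_ ?_ <;> intro ω hω <;>
        simp only [Finset.mem_filter] at hω
      · exact fun h => Fintype.mem_piFinset.1 hω.1.1 h
      · exact hω.2
      · exact hω.1.2
    · simp
  have hcomm : ∑ ω ∈ Ω, ((Finset.univ.filter fun R => Good ω R).card : ℝ) =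
      ∑ R, ((Ω.filter fun ω => Good ω R).card : ℝ) := by
    simp only [Finset.card_filter, Nat.cast_sum]
    exact Finset.sum_comm
  have h1 : (Ω.card : ℝ) * (2 ^ r / 4) ≤ 2 ^ r * (2 ^ s * (P * x) ^ l) := by
    calc (Ω.card : ℝ) * (2 ^ r / 4) = ∑ ω ∈ Ω, ((2 : ℝ) ^ r / 4) := by
          rw [Finset.sum_const, nsmul_eq_mul]
      _ ≤ _ := Finset.sum_le_sum fun ω _ => hlow ω
      _ = _ := hcomm
      _ ≤ ∑ R : Fin r → Bool, (2 ^ s * (P * x) ^ l : ℝ) := Finset.sum_le_sum fun R _ => hup R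
      _ = _ := by simp
  rw [hΩ, mul_pow] at h1
  have h2 : (P ^ l * 2 ^ r) * (1 / 4) ≤ (P ^ l * 2 ^ r) * (2 ^ s * x ^ l) := by linarith
  exact le_of_mul_le_mul_left h2 (by positivity)

end Counting

/-! ### The choice of the parameters -/

lemma le_card_block_mod (n q : ℕ) (hq : 0 < q) (j : Fin q) :
    n / q ≤ (block (fun v : Fin n => (⟨v % q, Nat.mod_lt _ hq⟩ : Fin q)) j).card := by
  have hlt : ∀ i : Fin (n / q), i * q + j < n := fun i => by
    have h1 : ((i : ℕ) + 1) * q ≤ n / q * q := Nat.mul_le_mul_right _ i.2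
    have h2 := Nat.div_mul_le_self n q
    have h3 := j.2
    linarith
  rw [← Fintype.card_fin (n / q), ← Finset.card_univ]
  refine Finset.card_le_card_of_injOn (fun i => ⟨i * q + j, hlt i⟩) (fun i _ => ?_) ?_
  · simp only [block, Finset.coe_filter, Finset.mem_univ, true_and, Set.mem_ofPred_eq]
    ext
    simp [Nat.mod_eq_of_lt j.2]
  · intro a _ b _ hab
    have := congrArg Fin.val hab
    simp only [add_left_inj] at this
    exact Fin.ext (Nat.eq_of_mul_eq_mul_right hq this)

/-- The logarithmic lower bound on `L` is used only through this absolute bound. -/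
lemma sixtySix_le {L n K : ℕ} (hKn : 2 * K ≤ n) (hLK : L + 1 ≤ K)
    (hL : 12 * Real.log (4 * (n : ℝ)) ≤ L) : 66 ≤ L := by
  have hlog2 := Real.log_two_gt_d9
  have key : ∀ k : ℕ, 2 ^ k ≤ 4 * n → 12 * (k * 0.6931471803) ≤ (L : ℝ) := fun k hk => by
    have h1 : ((2 : ℝ) ^ k) ≤ 4 * n := by exact_mod_cast hk
    have h2 := Real.log_le_log (by positivity) h1
    rw [Real.log_pow] at h2
    have h3 : (k : ℝ) * 0.6931471803 ≤ k * Real.log 2 :=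
      mul_le_mul_of_nonneg_left hlog2.le (Nat.cast_nonneg k)
    linarith
  have h1 : 24 ≤ L := by
    have := key 3 (by omega)
    have h : ((24 : ℕ) : ℝ) ≤ L := by push_cast at this ⊢; linarith
    exact_mod_cast h
  have h2 : 58 ≤ L := by
    have := key 7 (by omega)
    have h : ((58 : ℕ) : ℝ) ≤ L := by push_cast at this ⊢; linarith
    exact_mod_cast h
  have := key 8 (by omega)
  have h : ((66 : ℕ) : ℝ) ≤ L := by push_cast at this ⊢; linarith
  exact_mod_cast h

/-- The inequality between the constants. It is tightest near `n = 3 * K`, half-way between the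
multiples of `2 * K`. -/
lemma exponent_ge {n K q M : ℕ} (hK : 67 ≤ K) (hKn : 2 * K ≤ n) (hq : q = (n + K) / (2 * K))
    (hM : M = n / q) : (n : ℝ) / (5 * K) ≤ 0.94715 * (q * (1 - K / M)) := by
  have hq1 : 1 ≤ q := by
    rw [hq, Nat.le_div_iff_mul_le (by omega)]; omega
  have hqle : q * (2 * K) ≤ n + K := by rw [hq]; exact Nat.div_mul_le_self _ _
  have hqlt : n + K < (q + 1) * (2 * K) := by
    rw [hq, mul_comm]; exact Nat.lt_mul_div_succ _ (by omega)
  have hMq : n < (M + 1) * q := by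
    rw [hM, mul_comm]; exact Nat.lt_mul_div_succ _ (by omega)
  have hq1' : (1 : ℝ) ≤ q := by exact_mod_cast hq1
  have hK' : (67 : ℝ) ≤ K := by exact_mod_cast hK
  have hKn' : 2 * (K : ℝ) ≤ n := by exact_mod_cast hKn
  have hqle' : (q : ℝ) * (2 * K) ≤ n + K := by exact_mod_cast hqle
  have hqlt' : (n : ℝ) + K < (q + 1) * (2 * K) := by exact_mod_cast hqlt
  have hMq' : (n : ℝ) < (M + 1) * q := by exact_mod_cast hMq
  have hn0 : (0 : ℝ) < n := by linarith
  have hK0 : (0 : ℝ) < K := by linarith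
  have hqn : (q : ℝ) ≤ 0.012 * n := by nlinarith
  have hMqn : 0.988 * (n : ℝ) ≤ M * q := by linarith
  have hM0 : (0 : ℝ) < M := by
    by_contra h
    have : (M : ℝ) * q ≤ 0 := mul_nonpos_of_nonpos_of_nonneg (not_lt.1 h) (by linarith)
    linarith
  have hKM : (K : ℝ) / M ≤ 1.0122 * (K * q) / n := by
    rw [div_le_div_iff₀ hM0 hn0]
    nlinarith
  have hquad : 0.2 * (n : ℝ) ^ 2 ≤ 0.94715 * (K * q * n - 1.0122 * (K * q) ^ 2) := by
    rcases Nat.lt_or_ge q 2 with h | h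
    · have : q = 1 := by omega
      subst this
      push_cast at *
      nlinarith [mul_nonneg (sub_nonneg.2 hKn') (by linarith : (0 : ℝ) ≤ 3 * K - n)]
    · have h2 : (2 : ℝ) ≤ q := by exact_mod_cast h
      have hy : 2 * (K : ℝ) ≤ K * q := by nlinarith
      have hn3 : 3 * (K : ℝ) ≤ n := by linarith
      have hdev : (2 * (K * q : ℝ) - n) ^ 2 ≤ (K : ℝ) ^ 2 :=
        sq_le_sq' (by linarith) (by linarith)
      have hy2 : (2 * (K * q : ℝ)) ^ 2 ≤ (4 / 3 * n) ^ 2 :=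
        pow_le_pow_left₀ (by positivity) (by linarith) 2
      have hKsq : (3 * (K : ℝ)) ^ 2 ≤ (n : ℝ) ^ 2 := pow_le_pow_left₀ (by positivity) hn3 2
      nlinarith
  have h1 : (n : ℝ) / (5 * K) ≤ 0.94715 * (q * (1 - 1.0122 * (K * q) / n)) := by
    have h2 : 0.94715 * (q * (1 - 1.0122 * (K * q) / n)) =
        0.94715 * (K * q * n - 1.0122 * (K * q) ^ 2) / (K * n : ℝ) := by
      field_simp
    rw [h2, div_le_div_iff₀ (by positivity) (by positivity)]
    nlinarith
  refine h1.trans ?_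
  have : (1 - 1.0122 * (K * q) / n : ℝ) ≤ 1 - K / M := by linarith
  gcongr

lemma add_le_div {n K d q : ℕ} (hK : 67 ≤ K) (hKn : 2 * K ≤ n) (hd : 2 * d ≤ K + 2)
    (hq : q = (n + K) / (2 * K)) : 41 + d ≤ n / q := by
  have hq1 : 1 ≤ q := by
    rw [hq, Nat.le_div_iff_mul_le (by omega)]; omega
  have hqle : q * (2 * K) ≤ n + K := by rw [hq]; exact Nat.div_mul_le_self _ _
  rw [Nat.le_div_iff_mul_le hq1]
  have h1 : 100 * (41 + d) ≤ 113 * K := by omega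
  have h2 := Nat.mul_le_mul_right q h1
  have h3 : 113 * K * q * 2 = 113 * (q * (2 * K)) := by ring
  have h4 : 100 * (41 + d) * q = 100 * ((41 + d) * q) := by ring
  omega

end RobustColoring

theorem mainTheorem1 (L n K : ℕ) (hKn : 2 * K ≤ n) (hLK : L + 1 ≤ K)
    (hL : 12 * Real.log (4 * (n : ℝ)) ≤ (L : ℝ))
    (m : ℕ) (hm : n * L / 2 ≤ m)
    (s r : ℕ) (A : StreamAlg (EdgeToken n) (Fin n → Fin K) s r)
    (hA : A.IsRobust (ColoringProblem n L K) (3 / 4) m) :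
    1 / (40 * Real.log 2) * ((n : ℝ) * (L : ℝ) ^ 2 / (K : ℝ)) - 3 ≤ (s : ℝ) := by
  have hL66 := RobustColoring.sixtySix_le hKn hLK hL
  have hq0 : 0 < (n + K) / (2 * K) := Nat.div_pos (by omega) (by omega)
  -- `2 * l` of the degree limit goes to the random permutations and `d ≈ L / 2` to the probing.
  obtain ⟨l, d, hld, hdl, hd4⟩ : ∃ l d : ℕ, 2 * l + d = L ∧ 2 * l ≤ d ∧ d ≤ 2 * l + 3 :=
    ⟨L / 4, L - 2 * (L / 4), by omega, by omega, by omega⟩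
  have hdM := RobustColoring.add_le_div (d := d) (by omega) hKn (by omega) rfl
  have hexp := RobustColoring.exponent_ge (by omega) hKn rfl rfl
  have : Nonempty (EdgeToken n) := ⟨⟨s(⟨0, by omega⟩, ⟨1, by omega⟩), by simp⟩⟩
  have hcount := RobustColoring.quarter_le_of_isRobust hld.le hm
    (RobustColoring.le_card_block_mod n _ hq0) hdM hA
  rw [Fintype.card_fin] at hcount
  set q := (n + K) / (2 * K)
  set y : ℝ := (q : ℝ) * (1 - K / (n / q : ℕ)) with hy
  have hlog : (l : ℝ) * (19 / 20 * d * y) ≤ (s + 2) * Real.log 2 := by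
    have h := Real.log_le_log (by norm_num) hcount
    rw [Real.log_mul (by positivity) (by positivity), Real.log_pow, Real.log_pow, Real.log_exp,
      show (1 / 4 : ℝ) = (2 ^ 2)⁻¹ by norm_num, Real.log_inv, Real.log_pow] at h
    rw [hy]
    push_cast at h ⊢
    linarith
  have hK0 : (0 : ℝ) < K := by exact_mod_cast (by omega : 0 < K)
  have hlog2 : 0 < Real.log 2 := Real.log_pos (by norm_num)
  have hprod : 0.997 * (L : ℝ) ^ 2 ≤ 8 * (l * d) := by
    have h1 : (66 : ℝ) ≤ L := by exact_mod_cast hL66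
    have h2 : (2 * l + d : ℝ) = L := by exact_mod_cast hld
    have h3 : (2 * l : ℝ) ≤ d := by exact_mod_cast hdl
    have h4 : (d : ℝ) ≤ 2 * l + 3 := by exact_mod_cast hd4
    -- `8 * l * d = L ^ 2 - (d - 2 * l) ^ 2`
    have h5 : (d - 2 * l : ℝ) ^ 2 ≤ 3 ^ 2 := pow_le_pow_left₀ (by linarith) (by linarith) 2
    nlinarith
  have hy0 : 0 ≤ y := by
    have : (0 : ℝ) ≤ n / (5 * K) := by positivity
    linarith
  have hmain : (n : ℝ) * L ^ 2 / K / 40 ≤ (s + 2) * Real.log 2 := by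
    have h1 := mul_le_mul_of_nonneg_left hexp (show (0 : ℝ) ≤ (L : ℝ) ^ 2 / 8 by positivity)
    have h2 := mul_le_mul_of_nonneg_right hprod hy0
    have h3 : (n : ℝ) * L ^ 2 / K / 40 = (L : ℝ) ^ 2 / 8 * (n / (5 * K)) := by
      field_simp
      ring
    rw [h3]
    linarith
  have h4 : 1 / (40 * Real.log 2) * ((n : ℝ) * (L : ℝ) ^ 2 / (K : ℝ)) =
      (n : ℝ) * L ^ 2 / K / 40 / Real.log 2 := by
    field_simp
  rw [h4, sub_le_iff_le_add, div_le_iff₀ hlog2]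
  nlinarith
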